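/- Let $K$ be a field, let $1\le t\le n$ be integers, and let $S=K[x_1,\dots,x_n]$. For an ideal $J$ of $S$ let $\mathrm{ass}(J)$ denote the set of associated prime ideals of the $S$-module $S/J$, and call $J$ normally torsion-free if $\mathrm{ass}(J^s)=\mathrm{ass}(J)$ for all integers $s\ge 1$. Let $L_n$ be the line (path) graph with vertices $1,\dots,n$ and edges $\{j,j+1\}$ for $1\le j\le n-1$. The $t$-path ideal $I_t(L_n)$ is the ideal of $S$ generated by the monomials $x_{i_1}\cdots x_{i_t}$ for all paths $i_1,\dots,i_t$ of $L_n$ on $t$ pairwise distinct vertices (for $t=1$, single vertices); that is, $I_t(L_n)=(x_ix_{i+1}\cdots x_{i+t-1} : 1\le i\le n-t+1)$. For a squarefree monomial ideal $I$ of $S$, its Alexander dual $I^\vee$ is the ideal generated by the monomials $\prod_{i\in C}x_i$, where $C$ ranges over all subsets of $\{1,\dots,n\}$ that meet the support of every minimal monomial generator of $I$ (the vertex covers). Then both $I_t(L_n)$ and its Alexander dual $I_t(L_n)^\vee$ are normally torsion-free, i.e. for all $s\ge 1$, $$\mathrm{ass}(I_t(L_n)^s)=\mathrm{ass}(I_t(L_n))\quad\text{and}\quad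 \mathrm{ass}((I_t(L_n)^\vee)^s)=\mathrm{ass}(I_t(L_n)^\vee).$$ -/

import Mathlib

noncomputable section

namespace PathIdeals

/-- An ideal `I` is normally torsion-free if `ass (I ^ s) = ass I` for all `s ≥ 1`, where
`ass J` is the set of associated primes of the module `R ⧸ J`. -/
def NormallyTorsionFree {R : Type*} [CommRing R] (I : Ideal R) : Prop :=
  ∀ s : ℕ, 1 ≤ s → associatedPrimes R (R ⧸ I ^ s) = associatedPrimes R (R ⧸ I)

/-- The squarefree monomial `x_F`, the product of the variables indexed by `F`. -/
def sqfreeMonomial (K : Type*) [Field K] {V : Type*} (F : Finset V) : MvPolynomial V K :=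
  ∏ i ∈ F, MvPolynomial.X i

/-- The vertex sets of the `t`-paths of `G`: paths through `t` pairwise distinct vertices,
hence with `t - 1` edges. For `t = 1` these are the single vertices. -/
def tPaths {V : Type*} [DecidableEq V] (G : SimpleGraph V) (t : ℕ) : Set (Finset V) :=
  {F | ∃ (u v : V) (p : G.Walk u v), p.IsPath ∧ p.length + 1 = t ∧ F = p.support.toFinset}

/-- The `t`-path ideal `I_t(G)`. -/
def pathIdeal (K : Type*) [Field K] {V : Type*} [DecidableEq V] (G : SimpleGraph V) (t : ℕ) :
    Ideal (MvPolynomial V K) :=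
  Ideal.span (sqfreeMonomial K '' tPaths G t)

/-- For a squarefree monomial ideal `I`, the facets of the simplicial complex `Δ` whose facet
ideal is `I`: the sets `F` such that `x_F` is a minimal monomial generator of `I`. -/
def facets {K : Type*} [Field K] {V : Type*} (I : Ideal (MvPolynomial V K)) : Set (Finset V) :=
  {F | Minimal (fun F' : Finset V => sqfreeMonomial K F' ∈ I) F}

/-- `C` is a vertex cover of the simplicial complex with the given facets: it meets every facet. -/
def IsVertexCover {V : Type*} (facetSet : Set (Finset V)) (C : Finset V) : Prop :=
  ∀ F ∈ facetSet, ∃ i ∈ C, i ∈ F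

/-- The Alexander dual of a squarefree monomial ideal `I = I(Δ)`: the ideal generated by all
`x_C` with `C` a vertex cover of `Δ`. -/
def alexanderDual {K : Type*} [Field K] {V : Type*} (I : Ideal (MvPolynomial V K)) :
    Ideal (MvPolynomial V K) :=
  Ideal.span (sqfreeMonomial K '' {C | IsVertexCover (facets I) C})

end PathIdeals

end

/-! The vertex set of a path in a line is an interval. If `𝒢` is a family of intervals, then `𝒢` and
the family of its vertex covers both have the max-flow min-cut property. To pack intervals, place
the `k`-th one where the covering number of the intervals lying to the left passes `k`; to pack
covers, list the vertices in order with multiplicity and deal them out cyclically.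

For a monomial `x ^ a` the max-flow min-cut property says that it lies in the `s`-th power of the
ideal of the family as soon as it vanishes to order at least `s` along `x_i = 0`, `i ∈ C`, for every
minimal vertex cover `C`. Thus the `s`-th power is the intersection of the ideals of these vanishing
conditions, which are primary with pairwise incomparable radicals `(x_i : i ∈ C)` that do not depend
on `s`. -/

open Finset MvPolynomial

namespace PathIdeals

section Valuation

variable {R : Type*} [CommRing R]

/-- The ideal of elements of valuation at least `s`. For the order of vanishing along a coordinate
subspace this is the `s`-th symbolic power of the prime ideal of that subspace. -/
def valuationIdeal (v : AddValuation R ℕ∞) (s : ℕ) : Ideal R where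
  carrier := {f | s ≤ v f}
  add_mem' := v.map_le_add
  zero_mem' := by simp
  smul_mem' c f hf := by
    rw [Set.mem_ofPred_eq, smul_eq_mul, v.map_mul]
    exact le_add_left hf

variable {v : AddValuation R ℕ∞} {s : ℕ} {f : R}

theorem mem_valuationIdeal : f ∈ valuationIdeal v s ↔ s ≤ v f := Iff.rfl

theorem notMem_valuationIdeal_one : f ∉ valuationIdeal v 1 ↔ v f = 0 := by
  rw [mem_valuationIdeal, Nat.cast_one, not_le, Order.lt_one_iff]

theorem radical_valuationIdeal (hs : 1 ≤ s) :
    (valuationIdeal v s).radical = valuationIdeal v 1 := by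
  ext f
  constructor
  · rintro ⟨m, hm⟩
    by_contra hf
    rw [mem_valuationIdeal, v.map_pow, notMem_valuationIdeal_one.1 hf, smul_zero] at hm
    exact absurd (Nat.cast_le.1 (hm.trans Nat.cast_zero.ge)) (by lia)
  · intro hf
    refine ⟨s, ?_⟩
    rw [mem_valuationIdeal, v.map_pow]
    simpa using nsmul_le_nsmul_right (mem_valuationIdeal.1 hf) s

theorem isPrimary_valuationIdeal (hs : 1 ≤ s) : (valuationIdeal v s).IsPrimary := by
  rw [Ideal.isPrimary_iff, radical_valuationIdeal hs]
  refine ⟨?_, fun {f g} hfg => or_iff_not_imp_right.2 fun hg => ?_⟩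
  · rw [Ideal.ne_top_iff_one, mem_valuationIdeal, v.map_one]
    exact_mod_cast (by lia : ¬s ≤ 0)
  · rwa [mem_valuationIdeal, v.map_mul, notMem_valuationIdeal_one.1 hg, add_zero] at hfg

theorem valuationIdeal_one_pow_le (v : AddValuation R ℕ∞) (s : ℕ) :
    valuationIdeal v 1 ^ s ≤ valuationIdeal v s := by
  induction s with
  | zero => exact fun f _ => by simp [mem_valuationIdeal]
  | succ s ih =>
    rw [pow_succ, Ideal.mul_le]
    intro f hf g hg
    rw [mem_valuationIdeal, v.map_mul, Nat.cast_add]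
    exact add_le_add (ih hf) hg

end Valuation

section AssociatedPrimes

variable {R ι : Type*} [CommRing R]

theorem associatedPrimes_quotient (I : Ideal R) :
    associatedPrimes R (R ⧸ I) = Submodule.associatedPrimes I := by
  have colon_mk (x : R) :
      Submodule.colon (⊥ : Submodule R (R ⧸ I)) {Ideal.Quotient.mk I x} =
        Submodule.colon I {x} := by
    ext r
    rw [Submodule.mem_colon_singleton, Submodule.mem_colon_singleton, Submodule.mem_bot,
      smul_eq_mul, ← Ideal.Quotient.eq_zero_iff_mem, map_mul]
    rfl
  ext P
  rw [AssociatedPrimes.mem_iff, IsAssociatedPrime, Submodule.AssociatePrimes.mem_iff,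
    Submodule.isAssociatedPrime_def, Submodule.isAssociatedPrime_def,
    Ideal.Quotient.mk_surjective.exists]
  simp only [colon_mk]

theorem isMinimalPrimaryDecomposition_image {T : Finset ι}
    {q : ι → Ideal R} (hq : ∀ i ∈ T, (q i).IsPrimary)
    (hT : ∀ i ∈ T, ∀ j ∈ T, (q i).radical ≤ (q j).radical → i = j) :
    Submodule.IsMinimalPrimaryDecomposition (T.inf q) (T.image q) where
  inf_eq := by rw [inf_image, Function.id_comp]
  primary := by simpa only [forall_mem_image] using hq
  distinct := by
    rw [coe_image]
    rintro _ ⟨i, hi, rfl⟩ _ ⟨j, hj, rfl⟩ hne h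
    simp only [Submodule.colon_univ] at h
    exact hne (congrArg q (hT i hi j hj h.le))
  minimal := by
    rw [forall_mem_image]
    intro i hi hle
    have hprime : (q i).radical.IsPrime := Ideal.isPrime_radical (hq i hi)
    obtain ⟨J, hJ, hJi⟩ := hprime.inf_le'.1 (hle.trans Ideal.le_radical)
    obtain ⟨hne, hJ⟩ := mem_erase.1 hJ
    obtain ⟨j, hj, rfl⟩ := mem_image.1 hJ
    exact hne (congrArg q (hT j hj i hi (hprime.radical_le_iff.2 hJi)))

theorem associatedPrimes_quotient_inf {T : Finset ι} {q : ι → Ideal R}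
    (hq : ∀ i ∈ T, (q i).IsPrimary)
    (hT : ∀ i ∈ T, ∀ j ∈ T, (q i).radical ≤ (q j).radical → i = j) :
    associatedPrimes R (R ⧸ T.inf q) = (fun i => (q i).radical) '' T := by
  classical
  rw [associatedPrimes_quotient,
    ← (isMinimalPrimaryDecomposition_image hq hT).image_radical_eq_associated_primes, coe_image,
    Set.image_image]
  simp only [Submodule.colon_univ]

theorem normallyTorsionFree_of_pow_eq_inf {I : Ideal R} {T : Finset ι}
    {v : ι → AddValuation R ℕ∞}
    (hT : ∀ i ∈ T, ∀ j ∈ T, valuationIdeal (v i) 1 ≤ valuationIdeal (v j) 1 → i = j)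
    (hI : ∀ s, I ^ s = T.inf fun i => valuationIdeal (v i) s) :
    NormallyTorsionFree I := by
  have ass_pow (s : ℕ) (hs : 1 ≤ s) :
      associatedPrimes R (R ⧸ I ^ s) = (fun i => valuationIdeal (v i) 1) '' T := by
    rw [hI, associatedPrimes_quotient_inf (fun i _ => isPrimary_valuationIdeal hs)]
    · simp only [radical_valuationIdeal hs]
    · simpa only [radical_valuationIdeal hs] using hT
  intro s hs
  rw [ass_pow s hs, ← ass_pow 1 le_rfl, pow_one]

end AssociatedPrimes

section Monomial

variable {K : Type*} [Field K] {σ : Type*}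

theorem sqfreeMonomial_eq_monomial (F : Finset σ) :
    sqfreeMonomial K F = monomial (Finsupp.indicator F fun _ _ => 1) 1 := by
  rw [sqfreeMonomial, Finsupp.indicator_eq_sum_single, monomial_sum_one]
  simp only [X]

theorem sqfreeMonomial_mem_span_iff {𝒢 : Set (Finset σ)} {F : Finset σ} :
    sqfreeMonomial K F ∈ Ideal.span (sqfreeMonomial K '' 𝒢) ↔ ∃ G ∈ 𝒢, G ⊆ F := by
  classical
  have himg : sqfreeMonomial K '' 𝒢 = (fun a => monomial a (1 : K)) ''
      ((fun G : Finset σ => Finsupp.indicator G fun _ _ => 1) '' 𝒢) := by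
    rw [Set.image_image]
    exact Set.image_congr fun G _ => sqfreeMonomial_eq_monomial G
  rw [himg, mem_ideal_span_monomial_image, sqfreeMonomial_eq_monomial,
    support_monomial, if_neg one_ne_zero]
  simp only [mem_singleton, forall_eq, Set.exists_mem_image, Finsupp.le_def,
    Finsupp.indicator_apply]
  refine exists_congr fun G => and_congr_right fun _ => forall_congr' fun i => ?_
  split_ifs <;> simp_all

theorem isVertexCover_facets_span_iff {𝒢 : Set (Finset σ)} {C : Finset σ} :
    IsVertexCover (facets (Ideal.span (sqfreeMonomial K '' 𝒢))) C ↔ IsVertexCover 𝒢 C := by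
  constructor <;> intro hC F hF
  · obtain ⟨D, hDF, hD⟩ := exists_minimal_le_of_wellFoundedLT
      (fun F' : Finset σ => sqfreeMonomial K F' ∈ Ideal.span (sqfreeMonomial K '' 𝒢)) F
      (Ideal.subset_span ⟨F, hF, rfl⟩)
    exact (hC D hD).imp fun i => And.imp_right (@hDF i)
  · obtain ⟨G, hG, hGF⟩ := sqfreeMonomial_mem_span_iff.1 hF.1
    exact (hC G hG).imp fun i => And.imp_right (@hGF i)

theorem alexanderDual_span (𝒢 : Set (Finset σ)) :
    alexanderDual (Ideal.span (sqfreeMonomial K '' 𝒢)) =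
      Ideal.span (sqfreeMonomial K '' {C | IsVertexCover 𝒢 C}) := by
  simp only [alexanderDual, isVertexCover_facets_span_iff]

/-- The order of vanishing of a polynomial along the coordinate subspace `x_i = 0`, `i ∈ C`. -/
noncomputable def vanishingOrder (K : Type*) [Field K] {σ : Type*} (C : Finset σ) :
    AddValuation (MvPolynomial σ K) ℕ∞ :=
  AddValuation.of
    (fun f => (f : MvPowerSeries σ K).weightedOrder (Set.indicator C 1))
    (by simp) (by simp) (fun f g => by simpa using MvPowerSeries.min_weightedOrder_le_add _)
    (fun f g => by simpa using MvPowerSeries.weightedOrder_mul _ _ _)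

theorem weight_indicator_one (C : Finset σ) (a : σ →₀ ℕ) :
    Finsupp.weight (Set.indicator (C : Set σ) (1 : σ → ℕ)) a = ∑ i ∈ C, a i := by
  classical
  rw [Finsupp.weight_apply, Finsupp.sum_of_support_subset (s := a.support ∪ C) _
    subset_union_left _ (by simp)]
  simp [Set.indicator_apply]

theorem le_vanishingOrder_iff {C : Finset σ} {s : ℕ} {f : MvPolynomial σ K} :
    s ≤ vanishingOrder K C f ↔ ∀ a ∈ f.support, s ≤ ∑ i ∈ C, a i := by
  simp only [vanishingOrder, AddValuation.of_apply, ← weight_indicator_one]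
  constructor
  · intro h a ha
    rw [mem_support_iff, ← coeff_coe] at ha
    exact_mod_cast h.trans (MvPowerSeries.weightedOrder_le _ ha)
  · intro h
    refine MvPowerSeries.nat_le_weightedOrder _ fun d hd => ?_
    rw [coeff_coe, ← notMem_support_iff]
    exact fun hds => (h d hds).not_gt hd

theorem sqfreeMonomial_mem_valuationIdeal_one_iff {F C : Finset σ} :
    sqfreeMonomial K F ∈ valuationIdeal (vanishingOrder K C) 1 ↔ ∃ i ∈ C, i ∈ F := by
  classical
  rw [mem_valuationIdeal, le_vanishingOrder_iff, sqfreeMonomial_eq_monomial, support_monomial,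
    if_neg one_ne_zero]
  simp [Nat.one_le_iff_ne_zero, Finsupp.indicator_apply]

theorem subset_of_valuationIdeal_one_le {C D : Finset σ}
    (h : valuationIdeal (vanishingOrder K C) 1 ≤ valuationIdeal (vanishingOrder K D) 1) :
    C ⊆ D := by
  intro i hi
  have hiC : sqfreeMonomial K {i} ∈ valuationIdeal (vanishingOrder K C) 1 :=
    sqfreeMonomial_mem_valuationIdeal_one_iff.2 ⟨i, hi, mem_singleton_self i⟩
  obtain ⟨j, hj, hji⟩ := sqfreeMonomial_mem_valuationIdeal_one_iff.1 (h hiC)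
  rwa [mem_singleton.1 hji] at hj

end Monomial

section Mengerian

variable {K : Type*} [Field K] {σ : Type*} {𝒢 : Set (Finset σ)}

theorem span_pow_le_valuationIdeal {C : Finset σ} (hC : IsVertexCover 𝒢 C) (s : ℕ) :
    Ideal.span (sqfreeMonomial K '' 𝒢) ^ s ≤ valuationIdeal (vanishingOrder K C) s := by
  refine (Ideal.pow_right_mono ?_ s).trans (valuationIdeal_one_pow_le _ s)
  rw [Ideal.span_le, Set.image_subset_iff]
  exact fun F hF => sqfreeMonomial_mem_valuationIdeal_one_iff.2 (hC F hF)

variable [DecidableEq σ]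

/-- The max-flow min-cut property of a set of finite sets: for every weight on the vertices, if
all vertex covers have weight at least `s`, then `s` members, repetitions allowed, can be packed
so that each vertex lies in at most as many of them as its weight. -/
def IsMengerian (𝒢 : Set (Finset σ)) : Prop :=
  ∀ (s : ℕ) (a : σ → ℕ), (∀ C, IsVertexCover 𝒢 C → s ≤ ∑ i ∈ C, a i) →
    ∃ F : Fin s → Finset σ, (∀ k, F k ∈ 𝒢) ∧ ∀ i, #{k | i ∈ F k} ≤ a i

theorem monomial_mem_span_pow {s : ℕ} {F : Fin s → Finset σ} (hF : ∀ k, F k ∈ 𝒢)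
    {a : σ →₀ ℕ} (hFa : ∀ i, #{k | i ∈ F k} ≤ a i) (c : K) :
    monomial a c ∈ Ideal.span (sqfreeMonomial K '' 𝒢) ^ s := by
  have hprod : ∏ k, sqfreeMonomial K (F k) ∈ Ideal.span (sqfreeMonomial K '' 𝒢) ^ s := by
    simpa using Ideal.prod_mem_prod (s := univ)
      (I := fun _ : Fin s => Ideal.span (sqfreeMonomial K '' 𝒢))
      fun k _ => Ideal.subset_span (Set.mem_image_of_mem _ (hF k))
  refine Ideal.mem_of_dvd _ ?_ hprod
  simp_rw [sqfreeMonomial_eq_monomial]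
  rw [← monomial_sum_one, monomial_dvd_monomial]
  refine ⟨Or.inr fun i => ?_, one_dvd _⟩
  simpa [Finsupp.finsetSum_apply, Finsupp.indicator_apply] using hFa i

theorem IsMengerian.span_pow_eq_iInf (h𝒢 : IsMengerian 𝒢) (s : ℕ) :
    Ideal.span (sqfreeMonomial K '' 𝒢) ^ s =
      ⨅ C ∈ {C | Minimal (IsVertexCover 𝒢) C}, valuationIdeal (vanishingOrder K C) s := by
  refine le_antisymm (le_iInf₂ fun C hC => span_pow_le_valuationIdeal hC.1 s) fun f hf => ?_
  simp only [Submodule.mem_iInf, mem_valuationIdeal, le_vanishingOrder_iff] at hf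
  rw [f.as_sum]
  refine Ideal.sum_mem _ fun a ha => ?_
  have hcover (C : Finset σ) (hC : IsVertexCover 𝒢 C) : s ≤ ∑ i ∈ C, a i := by
    obtain ⟨D, hDC, hD⟩ := exists_minimal_le_of_wellFoundedLT (IsVertexCover 𝒢) C hC
    exact (hf D hD a ha).trans (sum_le_sum_of_subset hDC)
  obtain ⟨F, hF, hFa⟩ := h𝒢 s a hcover
  exact monomial_mem_span_pow hF hFa _

theorem IsMengerian.normallyTorsionFree_span [Finite σ] (h𝒢 : IsMengerian 𝒢) :
    NormallyTorsionFree (Ideal.span (sqfreeMonomial K '' 𝒢)) := by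
  have hfin : {C | Minimal (IsVertexCover 𝒢) C}.Finite := Set.toFinite _
  refine normallyTorsionFree_of_pow_eq_inf (T := hfin.toFinset) (v := vanishingOrder K) ?_ ?_
  · simp only [Set.Finite.mem_toFinset]
    intro C hC D hD hle
    exact hD.eq_of_le hC.1 (subset_of_valuationIdeal_one_le hle)
  · intro s
    rw [h𝒢.span_pow_eq_iInf, Finset.inf_eq_iInf]
    simp only [Set.Finite.mem_toFinset]

end Mengerian

section CoveringNumber

variable {σ : Type*} {𝒢 ℋ : Set (Finset σ)} {a : σ → ℕ}

/-- The least weight of a vertex cover; the junk value `0` if `∅ ∈ 𝒢`, as there are no covers. -/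
noncomputable def coveringNumber (𝒢 : Set (Finset σ)) (a : σ → ℕ) : ℕ :=
  ⨅ C : {C // IsVertexCover 𝒢 C}, ∑ i ∈ C.1, a i

theorem coveringNumber_le {C : Finset σ} (hC : IsVertexCover 𝒢 C) :
    coveringNumber 𝒢 a ≤ ∑ i ∈ C, a i :=
  ciInf_le (OrderBot.bddBelow _) (⟨C, hC⟩ : {C // IsVertexCover 𝒢 C})

theorem exists_sum_eq_coveringNumber [Finite σ] (h𝒢 : ∀ F ∈ 𝒢, F.Nonempty) (a : σ → ℕ) :
    ∃ C, IsVertexCover 𝒢 C ∧ ∑ i ∈ C, a i = coveringNumber 𝒢 a := by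
  have := Fintype.ofFinite σ
  have : Nonempty {C // IsVertexCover 𝒢 C} :=
    ⟨univ, fun F hF => (h𝒢 F hF).imp fun i hi => ⟨mem_univ i, hi⟩⟩
  obtain ⟨⟨C, hC⟩, h⟩ := ciInf_mem fun C : {C // IsVertexCover 𝒢 C} => ∑ i ∈ C.1, a i
  exact ⟨C, hC, h⟩

theorem coveringNumber_le_add [Finite σ] (h𝒢 : ∀ F ∈ 𝒢, F.Nonempty) {i : σ}
    (h : ∀ F ∈ ℋ, i ∈ F ∨ F ∈ 𝒢) : coveringNumber ℋ a ≤ coveringNumber 𝒢 a + a i := by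
  classical
  obtain ⟨C, hC, hCa⟩ := exists_sum_eq_coveringNumber h𝒢 a
  have hcover : IsVertexCover ℋ (insert i C) := by
    intro F hF
    obtain hi | hF := h F hF
    · exact ⟨i, mem_insert_self i C, hi⟩
    · exact (hC F hF).imp fun j => And.imp_left mem_insert_of_mem
  calc coveringNumber ℋ a ≤ ∑ j ∈ insert i C, a j := coveringNumber_le hcover
    _ ≤ ∑ j ∈ C, a j + a i := by
      rw [insert_eq, union_comm, ← sum_singleton a i, ← sum_union_inter]
      exact Nat.le_add_right _ _
    _ = coveringNumber 𝒢 a + a i := by rw [hCa]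

theorem nonempty_of_coveringNumber_pos (h : 0 < coveringNumber 𝒢 a) : 𝒢.Nonempty := by
  by_contra! rfl
  exact h.ne' (Nat.le_zero.1 (coveringNumber_le (C := ∅) (by simp [IsVertexCover])))

end CoveringNumber

section Interval

theorem exists_sum_filter_lt_le_and_lt {σ : Type*} [LinearOrder σ] {a : σ → ℕ} (S : Finset σ)
    {x : ℕ} (hx : x < ∑ i ∈ S, a i) :
    ∃ i ∈ S, ∑ j ∈ S with j < i, a j ≤ x ∧ x < ∑ j ∈ S with j < i, a j + a i := by
  induction S using Finset.induction_on_max with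
  | empty => simp at hx
  | insert m S hm ih =>
    have hmS : m ∉ S := fun h => (hm m h).false
    by_cases! hxS : x < ∑ i ∈ S, a i
    · obtain ⟨i, hi, h⟩ := ih hxS
      refine ⟨i, mem_insert_of_mem hi, ?_⟩
      rwa [filter_insert, if_neg (hm i hi).not_gt]
    · refine ⟨m, mem_insert_self m S, ?_⟩
      rw [filter_insert, if_neg (lt_irrefl m), filter_true_of_mem hm]
      rw [sum_insert hmS] at hx
      exact ⟨hxS, by lia⟩

variable {σ : Type*} [LinearOrder σ] {𝒢 : Set (Finset σ)} {a : σ → ℕ}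

/-- The members of `𝒢` lying strictly to the left of `i`. -/
def membersBefore (𝒢 : Set (Finset σ)) (i : σ) : Set (Finset σ) :=
  {F ∈ 𝒢 | ∀ j ∈ F, j < i}

theorem exists_subset_lt_coveringNumber [WellFoundedLT σ] {k : ℕ}
    (hk : k < coveringNumber 𝒢 a) :
    ∃ ℋ ⊆ 𝒢, k < coveringNumber ℋ a ∧
      ∀ F ∈ ℋ, ∀ i ∈ F, coveringNumber (membersBefore 𝒢 i) a ≤ k := by
  by_cases! h : ∃ i, k < coveringNumber (membersBefore 𝒢 i) a
  · obtain ⟨i, hi, hmin⟩ := WellFounded.has_min wellFounded_lt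
      {i | k < coveringNumber (membersBefore 𝒢 i) a} h
    exact ⟨membersBefore 𝒢 i, fun F hF => hF.1, hi,
      fun F hF j hj => not_lt.1 fun hjk => hmin j hjk (hF.2 j hj)⟩
  · exact ⟨𝒢, subset_rfl, hk, fun F _ i _ => h i⟩

theorem exists_mem_between_coveringNumbers [Finite σ] (hne : ∀ F ∈ 𝒢, F.Nonempty)
    (h𝒢 : ∀ F ∈ 𝒢, (F : Set σ).OrdConnected) {k : ℕ} (hk : k < coveringNumber 𝒢 a) :
    ∃ F ∈ 𝒢, ∀ i ∈ F, coveringNumber (membersBefore 𝒢 i) a ≤ k ∧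
      k < coveringNumber (membersBefore 𝒢 i) a + a i := by
  obtain ⟨ℋ, hℋ, hkℋ, hle⟩ := exists_subset_lt_coveringNumber hk
  -- Members of `ℋ` that start no later than `F` and avoid `i ∈ F` lie entirely to the left of `i`.
  obtain ⟨F, hF, hmax⟩ := Set.exists_max_image ℋ Finset.min (Set.toFinite ℋ)
    (nonempty_of_coveringNumber_pos (Nat.zero_lt_of_lt hkℋ))
  refine ⟨F, hℋ hF, fun i hi => ⟨hle F hF i hi, hkℋ.trans_le ?_⟩⟩
  refine coveringNumber_le_add (fun G hG => hne G hG.1) fun G hG => or_iff_not_imp_left.2 fun hiG =>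
    ⟨hℋ hG, fun j hj => ?_⟩
  obtain ⟨g, hg⟩ := min_of_nonempty (hne G (hℋ hG))
  have hgi : g ≤ i := WithTop.coe_le_coe.1 (hg ▸ (hmax G hG).trans (min_le hi))
  by_contra! hij
  exact hiG ((h𝒢 G (hℋ hG)).out (mem_of_min hg) hj ⟨hgi, hij⟩)

theorem isMengerian_of_ordConnected [Finite σ] (h𝒢 : ∀ F ∈ 𝒢, (F : Set σ).OrdConnected) :
    IsMengerian 𝒢 := by
  intro s a hs
  by_cases hempty : ∅ ∈ 𝒢
  · exact ⟨fun _ => ∅, fun _ => hempty, by simp⟩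
  have hne (F : Finset σ) (hF : F ∈ 𝒢) : F.Nonempty :=
    nonempty_iff_ne_empty.2 (ne_of_mem_of_not_mem hF hempty)
  have hs' : s ≤ coveringNumber 𝒢 a := by
    obtain ⟨C, hC, hCa⟩ := exists_sum_eq_coveringNumber hne a
    exact hCa ▸ hs C hC
  choose F hF hbetween using fun k : Fin s =>
    exists_mem_between_coveringNumbers hne h𝒢 (k.2.trans_le hs')
  refine ⟨F, hF, fun i => ?_⟩
  set m := coveringNumber (membersBefore 𝒢 i) a
  calc #{k | i ∈ F k} ≤ #(Ico m (m + a i)) :=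
        card_le_card_of_injOn Fin.val
          (fun k hk => mem_coe.2 (mem_Ico.2 (hbetween k i (by simpa using hk))))
          Fin.val_injective.injOn
    _ = a i := by simp

/-- The positions of the copies of `i` when the vertices are listed in increasing order, each `j`
repeated `a j` times. -/
def block [Fintype σ] (a : σ → ℕ) (i : σ) : Finset ℕ :=
  Ico (∑ j with j < i, a j) (∑ j with j < i, a j + a i)

theorem exists_Ico_subset_biUnion_block [Fintype σ] {F : Finset σ}
    (hF : (F : Set σ).OrdConnected) :
    ∃ m, Ico m (m + ∑ i ∈ F, a i) ⊆ F.biUnion (block a) := by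
  set L : Finset σ := {j | ∀ i ∈ F, j < i}
  have hsplit (i : σ) (hi : i ∈ F) :
      ∑ j with j < i, a j = ∑ j ∈ L, a j + ∑ j ∈ F with j < i, a j := by
    rw [← sum_union (disjoint_left.2 fun j hjL hjF => ?_)]
    · congr 1
      ext j
      simp only [L, mem_union, mem_filter, mem_univ, true_and]
      constructor
      · intro hji
        by_cases! hjF : ∀ i ∈ F, j < i
        · exact Or.inl hjF
        · obtain ⟨p, hp, hpj⟩ := hjF
          exact Or.inr ⟨hF.out hp hi ⟨hpj, hji.le⟩, hji⟩
      · exact fun h => h.elim (fun hj => hj i hi) And.right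
    · exact ((mem_filter_univ j).1 hjL j (mem_filter.1 hjF).1).false
  refine ⟨∑ j ∈ L, a j, fun x hx => ?_⟩
  rw [mem_Ico] at hx
  obtain ⟨i, hi, hle, hlt⟩ := exists_sum_filter_lt_le_and_lt (a := a) F
    (x := x - ∑ j ∈ L, a j) (by lia)
  refine mem_biUnion.2 ⟨i, hi, ?_⟩
  rw [block, mem_Ico, hsplit i hi]
  lia

theorem isMengerian_isVertexCover_of_ordConnected [Finite σ]
    (h𝒢 : ∀ F ∈ 𝒢, (F : Set σ).OrdConnected) :
    IsMengerian {C | IsVertexCover 𝒢 C} := by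
  have := Fintype.ofFinite σ
  intro s a hs
  have hsum (F : Finset σ) (hF : F ∈ 𝒢) : s ≤ ∑ i ∈ F, a i :=
    hs F fun C hC => (hC F hF).imp fun _ => And.symm
  -- Deal the listed copies of the vertices into `s` hands by position modulo `s`: the copies of an
  -- interval occupy at least `s` consecutive positions, so every hand meets it.
  refine ⟨fun k => {i | ∃ x ∈ block a i, x % s = k}, fun k F hF => ?_, fun i => ?_⟩
  · obtain ⟨m, hm⟩ := exists_Ico_subset_biUnion_block (a := a) (h𝒢 F hF)
    obtain ⟨x, hx, hxk⟩ : ∃ x ∈ Ico m (m + s), x % s = k := by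
      rw [← mem_image, Nat.image_Ico_mod]
      exact mem_range.2 k.2
    obtain ⟨i, hi, hxi⟩ := mem_biUnion.1
      (hm (Ico_subset_Ico_right (by gcongr; exact hsum F hF) hx))
    exact ⟨i, by simpa using ⟨x, hxi, hxk⟩, hi⟩
  · calc #{k : Fin s | i ∈ ({i | ∃ x ∈ block a i, x % s = k} : Finset σ)} ≤ #(block a i) := by
          refine card_le_card_of_forall_subsingleton (fun k x => x % s = k.1) ?_ ?_
          · simp
          · rintro x - k ⟨-, hk⟩ l ⟨-, hl⟩
            exact Fin.ext (hk.symm.trans hl)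
      _ = a i := by simp [block]

end Interval

section HasseGraph

variable {α : Type*} [LinearOrder α]

theorem ordConnected_insert_of_covBy {S : Set α} (hS : S.OrdConnected) {u v : α} (hv : v ∈ S)
    (huv : u ⋖ v ∨ v ⋖ u) : (insert u S).OrdConnected := by
  have uIcc_subset_insert {y : α} (hy : y ∈ S) : Set.uIcc u y ⊆ insert u S := by
    refine fun z hz => or_iff_not_imp_left.2 fun hzu => hS.uIcc_subset hv hy ?_
    rw [Set.mem_uIcc] at hz ⊢
    rcases huv with h | h
    · exact hz.imp (fun hz => ⟨h.ge_of_gt (hz.1.lt_of_ne' hzu), hz.2⟩)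
        fun hz => ⟨hz.1, hz.2.trans h.le⟩
    · exact hz.imp (fun hz => ⟨h.le.trans hz.1, hz.2⟩)
        fun hz => ⟨hz.1, h.le_of_lt (hz.2.lt_of_ne hzu)⟩
  rw [Set.ordConnected_iff_uIcc_subset]
  rintro x (rfl | hx) y (rfl | hy)
  · simp
  · exact uIcc_subset_insert hy
  · exact Set.uIcc_comm x y ▸ uIcc_subset_insert hx
  · exact (hS.uIcc_subset hx hy).trans (Set.subset_insert u S)

theorem ordConnected_support_hasse {u v : α} (p : (SimpleGraph.hasse α).Walk u v) :
    {w | w ∈ p.support}.OrdConnected := by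
  induction p with
  | nil =>
    simp only [SimpleGraph.Walk.support_nil, List.mem_singleton]
    exact Set.ordConnected_singleton
  | cons hadj p ih =>
    simp only [SimpleGraph.Walk.support_cons, List.mem_cons]
    exact ordConnected_insert_of_covBy ih p.start_mem_support (SimpleGraph.hasse_adj.1 hadj)

theorem ordConnected_of_mem_tPaths_hasse {t : ℕ} {F : Finset α}
    (hF : F ∈ tPaths (SimpleGraph.hasse α) t) : (F : Set α).OrdConnected := by
  obtain ⟨u, v, p, -, -, rfl⟩ := hF
  simpa using ordConnected_support_hasse p

end HasseGraph

end PathIdeals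

theorem theorem2p3_general (K : Type*) [Field K] {σ : Type*} [LinearOrder σ] [Finite σ]
    {𝒢 : Set (Finset σ)} (h𝒢 : ∀ F ∈ 𝒢, (F : Set σ).OrdConnected) :
    PathIdeals.NormallyTorsionFree (Ideal.span (PathIdeals.sqfreeMonomial K '' 𝒢)) ∧
      PathIdeals.NormallyTorsionFree
        (PathIdeals.alexanderDual (Ideal.span (PathIdeals.sqfreeMonomial K '' 𝒢))) := by
  rw [PathIdeals.alexanderDual_span]
  exact ⟨(PathIdeals.isMengerian_of_ordConnected h𝒢).normallyTorsionFree_span,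
    (PathIdeals.isMengerian_isVertexCover_of_ordConnected h𝒢).normallyTorsionFree_span⟩

theorem theorem2p3 (K : Type*) [Field K] (n t : ℕ) (ht : 1 ≤ t) (htn : t ≤ n) :
    PathIdeals.NormallyTorsionFree
        (PathIdeals.pathIdeal K (SimpleGraph.pathGraph n) t) ∧
      PathIdeals.NormallyTorsionFree
        (PathIdeals.alexanderDual (PathIdeals.pathIdeal K (SimpleGraph.pathGraph n) t)) := by
  exact theorem2p3_general K fun _ => PathIdeals.ordConnected_of_mem_tPaths_hasse
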